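/- All graphs are finite and simple; multigraphs are finite and may have parallel edges but no loops. $\Delta(Q)$ is the maximum degree of $Q$ (degrees count incident edges) and $\|Q\|$ its number of edges. A set of points in the plane is in general position if no three of its points are collinear and no three distinct line segments between pairs of its points have a common point unless all three share an endpoint. A rectilinear drawing of a multigraph $Q$ represents $V(Q)$ by $|V(Q)|$ points in general position and each edge by the line segment between its endpoints. A crossing-pair is a pair of edges with no common endpoint whose segments intersect, and the rectilinear crossing number $\mathrm{rcr}(Q)$ is the minimum number of crossing-pairs over all rectilinear drawings of $Q$. Let $k\ge 1$ be an integer. A multigraph $Q$ is a $(\le k)$-simplicial blowup of a graph $G$ if it is obtained from $G$ by adding an independent set $S$ of new vertices, joining each $u\in S$ to all the vertices of some clique $K_u$ of $G$ with $|K_u|\le k$ by one or more parallel edges each, and finally deleting zero or more edges of $G$ each of which has both endpoints in some $K_u$. A graph $R$ is $(k,c)$-agreeable if $\mathrm{rcr}(R^*)\le c\,\Delta(R^*)\,\|R^*\|$ for every $(\le k)$-simplicial blowup $R^*$ of every induced subgraph of $R$. A graph is obtained by attaching a graph $P$ to a graph $H$ by a $(\le k)$-clique-sum if it arises from the disjoint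 union of $H$ and $P$ by identifying, for some $1\le l\le k$, a clique of size $l$ of $H$ with a clique of size $l$ of $P$ to a clique $C$, and then possibly deleting some of the edges inside $C$, where an edge may be deleted only if each of its two endpoints has a neighbour in $P$ outside $C$. A graph is obtained by $(\le k)$-clique-sums of $G_1,\dots,G_h$ if, up to isomorphism, it is produced by starting with one of these graphs and attaching the others one after the other, in any order, to the graph constructed so far. **Theorem.** Let $c>0$ be a real number, $k\ge 1$ an integer, and $G_1,\dots,G_h$ graphs each of which is $(k,c)$-agreeable. Then every graph $G$ obtained by $(\le k)$-clique-sums of $G_1,\dots,G_h$ satisfies $$\mathrm{rcr}(G)\ \le\ k\,(c+2)\,\Delta(G)\,\|G\|.$$ -/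

import Mathlib

universe u

/-! ### Rectilinear drawings of multigraphs and the rectilinear crossing number -/

/-- The Euclidean plane. -/
abbrev Plane : Type := EuclideanSpace ℝ (Fin 2)

/-- A set of points in the plane is in general position if no three of its points lie on one line,
and no three (distinct) line segments between pairs of its points intersect in one point unless all
three share a common endpoint. -/
def GeneralPosition (P : Set Plane) : Prop :=
  (∀ a ∈ P, ∀ b ∈ P, ∀ c ∈ P, a ≠ b → a ≠ c → b ≠ c → ¬ Collinear ℝ {a, b, c}) ∧
  (∀ a ∈ P, ∀ b ∈ P, ∀ c ∈ P, ∀ d ∈ P, ∀ e ∈ P, ∀ f ∈ P,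
    a ≠ b → c ≠ d → e ≠ f →
    s(a, b) ≠ s(c, d) → s(a, b) ≠ s(e, f) → s(c, d) ≠ s(e, f) →
    (segment ℝ a b ∩ segment ℝ c d ∩ segment ℝ e f).Nonempty →
    ∃ v, v ∈ s(a, b) ∧ v ∈ s(c, d) ∧ v ∈ s(e, f))

namespace Graph

variable {α β : Type*}

/-- A rectilinear drawing of a multigraph `Q` represents the vertices of `Q` by distinct points in
general position; every edge is then represented by the line segment between its endpoints. -/
def IsRectilinearDrawing (Q : Graph α β) (p : α → Plane) : Prop :=
  Set.InjOn p Q.vertexSet ∧ GeneralPosition (p '' Q.vertexSet)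

/-- The edges `e` and `f` have no endpoint in common and their line segments intersect. -/
def Crosses (Q : Graph α β) (p : α → Plane) (e f : β) : Prop :=
  ∃ a b c d, Q.IsLink e a b ∧ Q.IsLink f c d ∧ a ≠ c ∧ a ≠ d ∧ b ≠ c ∧ b ≠ d ∧
    (segment ℝ (p a) (p b) ∩ segment ℝ (p c) (p d)).Nonempty

/-- The crossing-pairs (unordered pairs of edges) of a drawing. -/
def crossingPairs (Q : Graph α β) (p : α → Plane) : Set (Sym2 β) :=
  {z | ∃ e f, z = s(e, f) ∧ Q.Crosses p e f}

/-- The rectilinear crossing number of a (finite) multigraph: the minimum number of crossing-pairs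
over all its rectilinear drawings. -/
noncomputable def rectilinearCrossingNumber (Q : Graph α β) : ℕ :=
  sInf {n | ∃ p : α → Plane, Q.IsRectilinearDrawing p ∧ n = (Q.crossingPairs p).ncard}

/-- The degree of a vertex of a loopless multigraph: the number of edges incident with it. -/
noncomputable def degree (Q : Graph α β) (v : α) : ℕ := {e | Q.Inc e v}.ncard

/-- The maximum degree of a finite multigraph (`0` if there are no vertices). -/
noncomputable def maxDegree (Q : Graph α β) : ℕ := ⨆ v : Q.vertexSet, Q.degree v

/-- The number of edges of a finite multigraph. -/
noncomputable def numEdges (Q : Graph α β) : ℕ := Q.edgeSet.ncard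

end Graph

namespace SimpleGraph

/-- A simple graph, viewed as a multigraph; its edges are the unordered pairs of adjacent
vertices. -/
def toMultigraph {V : Type*} (G : SimpleGraph V) : Graph V (Sym2 V) where
  vertexSet := Set.univ
  IsLink e x y := G.Adj x y ∧ e = s(x, y)
  isLink_symm := by
    intro e _
    exact ⟨fun x y h => ⟨h.1.symm, h.2.trans Sym2.eq_swap⟩⟩
  eq_or_eq_of_isLink_of_isLink := by
    rintro e x y v w ⟨_, rfl⟩ ⟨_, h⟩
    rw [Sym2.eq_iff] at h
    tauto
  left_mem_of_isLink := fun _ _ _ _ => Set.mem_univ _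

/-- The rectilinear crossing number of a simple graph. -/
noncomputable def rcr {V : Type*} (G : SimpleGraph V) : ℕ :=
  G.toMultigraph.rectilinearCrossingNumber

/-! ### Simplicial blowups and agreeable graphs -/

/-- `Q` is a `(≤ k)`-simplicial blowup of the graph `G`: the vertices of `Q` are those of `G`
together with a set `S` of new vertices, and `K u` is the clique of `G` to which the new vertex `u`
is attached. -/
def IsSimplicialBlowup {V S E : Type*} (k : ℕ) (G : SimpleGraph V) (Q : Graph (V ⊕ S) E) : Prop :=
  Q.vertexSet = Set.univ ∧
  ∃ K : S → Set V,
    -- each `K u` is a clique of `G` of size at most `k`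
    (∀ u, G.IsClique (K u) ∧ (K u).ncard ≤ k) ∧
    -- the new vertices form an independent set
    (∀ e u v, ¬ Q.IsLink e (Sum.inr u) (Sum.inr v)) ∧
    -- `u` is joined, by one or more parallel edges, to precisely the vertices of `K u`
    (∀ u v, (∃ e, Q.IsLink e (Sum.inl v) (Sum.inr u)) ↔ v ∈ K u) ∧
    -- between old vertices there are only edges of `G`, none of them doubled
    (∀ e a b, Q.IsLink e (Sum.inl a) (Sum.inl b) → G.Adj a b) ∧
    (∀ e f a b, Q.IsLink e (Sum.inl a) (Sum.inl b) → Q.IsLink f (Sum.inl a) (Sum.inl b) → e = f) ∧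
    -- only edges of `G` inside one of the cliques `K u` may have been deleted
    (∀ a b, G.Adj a b → (∀ e, ¬ Q.IsLink e (Sum.inl a) (Sum.inl b)) → ∃ u, a ∈ K u ∧ b ∈ K u)

/-- `R` is `(k, c)`-agreeable: every `(≤ k)`-simplicial blowup `Q` of every induced subgraph of `R`
has rectilinear crossing number at most `c · Δ(Q) · ‖Q‖`. -/
def Agreeable {V : Type u} (k : ℕ) (c : ℝ) (R : SimpleGraph V) : Prop :=
  ∀ (U : Set V) (S E : Type u) [Finite S] [Finite E] (Q : Graph (U ⊕ S) E),
    IsSimplicialBlowup k (R.induce U) Q →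
      (Q.rectilinearCrossingNumber : ℝ) ≤ c * (Q.maxDegree : ℝ) * (Q.numEdges : ℝ)

/-! ### Clique-sums -/

/-- `G` arises from `H` by attaching `P` by a `(≤ k)`-clique-sum: (copies under `f` and `g` of) `H`
and `P` are identified at a nonempty clique `C = f(H) ∩ g(P)` of both of size at most `k`, and
afterwards some of the edges inside `C` may be deleted, where an edge may be deleted only if each
of its endpoints has a neighbour in `P` outside `C`. -/
def IsCliqueSum {A B V : Type*} (k : ℕ) (H : SimpleGraph A) (P : SimpleGraph B)
    (G : SimpleGraph V) : Prop :=
  ∃ (f : A ↪ V) (g : B ↪ V) (C : Set V),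
    Set.range f ∪ Set.range g = Set.univ ∧
    C = Set.range f ∩ Set.range g ∧
    1 ≤ C.ncard ∧ C.ncard ≤ k ∧
    H.IsClique (f ⁻¹' C) ∧ P.IsClique (g ⁻¹' C) ∧
    (∀ x y, G.Adj x y → (H.map f ⊔ P.map g).Adj x y) ∧
    (∀ x y, (H.map f ⊔ P.map g).Adj x y → ¬ G.Adj x y →
      x ∈ C ∧ y ∈ C ∧
      (∃ z, z ∉ C ∧ (P.map g).Adj x z) ∧ (∃ z, z ∉ C ∧ (P.map g).Adj y z))

/-- `ObtainedByCliqueSums k P I G`: the graph `G` is (isomorphic to) a graph obtained by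
`(≤ k)`-clique-sums of the graphs `P i`, `i ∈ I`, each used exactly once: one starts with one of
them and attaches the others one after the other. -/
inductive ObtainedByCliqueSums {ι : Type} {W : ι → Type u} (k : ℕ)
    (P : (i : ι) → SimpleGraph (W i)) : Set ι → {V : Type u} → SimpleGraph V → Prop
  | piece (i : ι) {V : Type u} (G : SimpleGraph V) (e : Nonempty (P i ≃g G)) :
      ObtainedByCliqueSums k P {i} G
  | sum (I : Set ι) (i : ι) (hi : i ∉ I) {A V : Type u} (H : SimpleGraph A) (G : SimpleGraph V)
      (hH : ObtainedByCliqueSums k P I H) (hG : IsCliqueSum k H (P i) G) :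
      ObtainedByCliqueSums k P (insert i I) G

end SimpleGraph

/-! Clique-sums are handled by induction, with a hypothesis stronger than the theorem:
`HasBlowupDrawings` concerns all simplicial blowups `M` of the graph, and bounds not only
crossing-pairs but also pairs of edges meeting at a new vertex. Paying for the latter in advance
allows a new vertex to be replaced later by a whole drawing, since edges that met there may then
cross.

Let `G` arise from `H` by attaching `P`, and let `M` be a blowup of `G`. Contract the part of `P`
outside `H`, with the new vertices attached to it, to a single new vertex. The result `M'` is a
blowup of `H`, and the contracted part `Q` is a blowup of an induced subgraph of `P`. Draw `M'` by
induction and `Q` by agreeability, then put a tiny copy of the drawing of `Q` at the contracted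
vertex (`exists_blowup_configuration`).

By `Graph.crossingPairs_subset` and `Graph.pairsAt_subset`, a pair counted for `M` is counted for
`M'`, crosses in `Q`, or consists of an edge of `Q` and an edge that either ends at the contracted
vertex or shares a new vertex with it. A new vertex has at most `k` neighbours, all old, hence
degree at most `k * Δ`, so these cases beyond `M'` cost at most `c * k * Δ`, `k * Δ` and `k * Δ` per
edge of `Q`. Since the edges of `M'` and `Q` are disjoint sets of edges of `M`, the bound is
preserved.

Only old vertices are required to have degree at most `Δ`: contraction does not raise these degrees,
whereas the contracted vertex may have larger degree. -/

section

open Set Filter Topology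

/-! ### Points in general position -/

/-- No three distinct points of `S` are collinear. -/
def NoThreeCollinear (S : Set Plane) : Prop :=
  ∀ a ∈ S, ∀ b ∈ S, ∀ c ∈ S, a ≠ b → a ≠ c → b ≠ c → ¬ Collinear ℝ {a, b, c}

theorem NoThreeCollinear.eq_or_eq_of_mem_segment {S : Set Plane} (hS : NoThreeCollinear S)
    {a b m : Plane} (ha : a ∈ S) (hb : b ∈ S) (hm : m ∈ S) (hab : a ≠ b)
    (h : m ∈ segment ℝ a b) : m = a ∨ m = b := by
  by_contra! hne
  exact hS a ha m hm b hb hne.1.symm hab hne.2 (mem_segment_iff_wbtw.1 h).collinear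

/-- Two common points would span a line through all four endpoints, at least three of which are
distinct. -/
theorem NoThreeCollinear.segment_inter_subsingleton {S : Set Plane} (hS : NoThreeCollinear S)
    {a b c d : Plane} (ha : a ∈ S) (hb : b ∈ S) (hc : c ∈ S) (hd : d ∈ S) (hab : a ≠ b)
    (hcd : c ≠ d) (hne : s(a, b) ≠ s(c, d)) :
    (segment ℝ a b ∩ segment ℝ c d).Subsingleton := by
  rintro m ⟨hm1, hm2⟩ m' ⟨hm1', hm2'⟩
  by_contra hmm
  have key : ∀ {x y : Plane}, m ∈ segment ℝ x y → m' ∈ segment ℝ x y →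
      x ∈ line[ℝ, m, m'] ∧ y ∈ line[ℝ, m, m'] := by
    intro x y h h'
    have hcol := collinear_insert_insert_of_mem_affineSpan_pair
      (mem_segment_iff_wbtw.1 h).mem_affineSpan (mem_segment_iff_wbtw.1 h').mem_affineSpan
    exact ⟨hcol.mem_affineSpan_of_mem_of_ne (by simp) (by simp) (by simp) hmm,
      hcol.mem_affineSpan_of_mem_of_ne (by simp) (by simp) (by simp) hmm⟩
  obtain ⟨la, lb⟩ := key hm1 hm1'
  obtain ⟨lc, ld⟩ := key hm2 hm2'
  by_cases hc' : a ≠ c ∧ b ≠ c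
  · exact hS a ha b hb c hc hab hc'.1 hc'.2 (collinear_triple_of_mem_affineSpan_pair la lb lc)
  · refine hS a ha b hb d hd hab ?_ ?_ (collinear_triple_of_mem_affineSpan_pair la lb ld)
    · rintro rfl
      apply hne
      grind [Sym2.eq_swap]
    · rintro rfl
      apply hne
      grind [Sym2.eq_swap]

theorem affineSpan_pair_ne_top (a b : Plane) : line[ℝ, a, b] ≠ ⊤ := by
  intro h
  have h1 := (collinear_pair ℝ a b).finrank_le_one
  rw [← direction_affineSpan, h, AffineSubspace.direction_top, finrank_top] at h1
  simp at h1

theorem dense_compl_lines {T : Set Plane} (hT : T.Finite) :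
    Dense {z : Plane | ∀ a ∈ T, ∀ b ∈ T, z ∉ line[ℝ, a, b]} := by
  refine MeasureTheory.Measure.dense_of_ae (μ := MeasureTheory.volume) ?_
  refine (MeasureTheory.ae_ball_iff hT.countable).2 fun a _ =>
    (MeasureTheory.ae_ball_iff hT.countable).2 fun b _ => ?_
  exact MeasureTheory.measure_eq_zero_iff_ae_notMem.1
    (MeasureTheory.Measure.addHaar_affineSubspace _ _ (affineSpan_pair_ne_top a b))

/-- The points in which two distinct segments between points of `S` meet. -/
def segmentCrossings (S : Set Plane) : Set Plane :=
  {m | ∃ a ∈ S, ∃ b ∈ S, ∃ c ∈ S, ∃ d ∈ S, a ≠ b ∧ c ≠ d ∧ s(a, b) ≠ s(c, d) ∧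
    m ∈ segment ℝ a b ∩ segment ℝ c d}

theorem NoThreeCollinear.finite_segmentCrossings {S : Set Plane} (hS : NoThreeCollinear S)
    (hf : S.Finite) : (segmentCrossings S).Finite := by
  have hfin : (⋃ a ∈ S, ⋃ b ∈ S, ⋃ c ∈ S, ⋃ d ∈ S,
      {m | a ≠ b ∧ c ≠ d ∧ s(a, b) ≠ s(c, d) ∧ m ∈ segment ℝ a b ∩ segment ℝ c d}).Finite := by
    refine hf.biUnion fun a ha => hf.biUnion fun b hb => hf.biUnion fun c hc =>
      hf.biUnion fun d hd => Set.Subsingleton.finite ?_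
    rintro m ⟨h1, h2, h3, h4⟩ m' ⟨-, -, -, h4'⟩
    exact hS.segment_inter_subsingleton ha hb hc hd h1 h2 h3 h4 h4'
  refine hfin.subset ?_
  rintro m ⟨a, ha, b, hb, c, hc, d, hd, h⟩
  simp only [mem_iUnion]
  exact ⟨a, ha, b, hb, c, hc, d, hd, h⟩

/-- Segments ending at `z` meet each other only in `z`. A segment from `z` to `x` can pass through
an old crossing point only at `x` itself, as otherwise `z` would lie on the line through `x` and
that point. -/
theorem GeneralPosition.insert {S : Set Plane} (hS : GeneralPosition S) {z : Plane}
    (hz : ∀ a ∈ S ∪ segmentCrossings S, ∀ b ∈ S ∪ segmentCrossings S, z ∉ line[ℝ, a, b]) :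
    GeneralPosition (insert z S) := by
  have hS1 : NoThreeCollinear S := hS.1
  have hzl : ∀ a ∈ S, ∀ b ∈ S, a ≠ b → ∀ T : Set Plane, z ∈ T → a ∈ T → b ∈ T →
      ¬ Collinear ℝ T := fun a ha b hb hab T h1 h2 h3 h =>
    hz a (.inl ha) b (.inl hb) (h.mem_affineSpan_of_mem_of_ne h2 h3 h1 hab)
  have hN : NoThreeCollinear (Insert.insert z S) := by
    rintro a (rfl | ha) b (rfl | hb) c (rfl | hc) hab hac hbc
    · exact (hab rfl).elim
    · exact (hab rfl).elim
    · exact (hac rfl).elim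
    · exact hzl b hb c hc hbc _ (by simp) (by simp) (by simp)
    · exact (hbc rfl).elim
    · exact hzl a ha c hc hac _ (by simp) (by simp) (by simp)
    · exact hzl a ha b hb hab _ (by simp) (by simp) (by simp)
    · exact hS1 a ha b hb c hc hab hac hbc
  have two : ∀ a ∈ Insert.insert z S, ∀ b ∈ Insert.insert z S, ∀ c ∈ Insert.insert z S,
      ∀ d ∈ Insert.insert z S, ∀ e ∈ Insert.insert z S, ∀ f ∈ Insert.insert z S,
      a ≠ b → c ≠ d → e ≠ f → s(a, b) ≠ s(c, d) → z ∈ s(a, b) → z ∈ s(c, d) →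
      ∀ m, m ∈ segment ℝ a b → m ∈ segment ℝ c d → m ∈ segment ℝ e f →
      ∃ v, v ∈ s(a, b) ∧ v ∈ s(c, d) ∧ v ∈ s(e, f) := by
    intro a ha b hb c hc d hd e he f hf hab hcd hef h1 hz1 hz2 m m1 m2 m3
    have hzs : ∀ x y : Plane, z ∈ s(x, y) → z ∈ segment ℝ x y := by
      intro x y h
      rcases Sym2.mem_iff.1 h with rfl | rfl
      exacts [left_mem_segment _ _ _, right_mem_segment _ _ _]
    have : m = z := hN.segment_inter_subsingleton ha hb hc hd hab hcd h1 ⟨m1, m2⟩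
      ⟨hzs _ _ hz1, hzs _ _ hz2⟩
    subst this
    exact ⟨m, hz1, hz2, Sym2.mem_iff.2
      (hN.eq_or_eq_of_mem_segment he hf (mem_insert _ _) hef m3)⟩
  have one : ∀ a ∈ Insert.insert z S, ∀ b ∈ Insert.insert z S, ∀ c ∈ S,
      ∀ d ∈ S, ∀ e ∈ S, ∀ f ∈ S, a ≠ b → c ≠ d → e ≠ f → s(c, d) ≠ s(e, f) → z ∈ s(a, b) →
      ∀ m, m ∈ segment ℝ a b → m ∈ segment ℝ c d → m ∈ segment ℝ e f →
      ∃ v, v ∈ s(a, b) ∧ v ∈ s(c, d) ∧ v ∈ s(e, f) := by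
    intro a ha b hb c hc d hd e he f hf hab hcd hef h1 hz1 m m1 m2 m3
    obtain ⟨x, hx⟩ := Sym2.mem_iff_exists.1 hz1
    have hxz : x ≠ z := by
      rintro rfl
      rcases Sym2.eq_iff.1 hx with ⟨h, h'⟩ | ⟨h, h'⟩ <;> exact hab (h.trans h'.symm)
    have hxS : x ∈ S := by
      have : x ∈ s(a, b) := hx ▸ Sym2.mem_mk_right _ _
      rcases Sym2.mem_iff.1 this with rfl | rfl
      · exact ha.resolve_left hxz
      · exact hb.resolve_left hxz
    have hmx : m ∈ segment ℝ z x := by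
      rcases Sym2.eq_iff.1 hx with ⟨rfl, rfl⟩ | ⟨rfl, rfl⟩
      · exact m1
      · rwa [segment_symm]
    have hmc : m ∈ segmentCrossings S := ⟨c, hc, d, hd, e, he, f, hf, hcd, hef, h1, m2, m3⟩
    have : m = x := by
      by_contra hne
      exact hz x (.inl hxS) m (.inr hmc)
        ((mem_segment_iff_wbtw.1 hmx).left_mem_affineSpan_of_right_ne (Ne.symm hne))
    subst this
    exact ⟨m, hx ▸ Sym2.mem_mk_right _ _,
      Sym2.mem_iff.2 (hS1.eq_or_eq_of_mem_segment hc hd hxS hcd m2),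
      Sym2.mem_iff.2 (hS1.eq_or_eq_of_mem_segment he hf hxS hef m3)⟩
  refine ⟨hN, ?_⟩
  rintro a ha b hb c hc d hd e he f hf hab hcd hef h1 h2 h3 ⟨m, ⟨m1, m2⟩, m3⟩
  have old : ∀ x ∈ Insert.insert z S, ∀ y ∈ Insert.insert z S, z ∉ s(x, y) → x ∈ S ∧ y ∈ S := by
    intro x hx y hy h
    rw [Sym2.mem_iff, not_or] at h
    exact ⟨hx.resolve_left (Ne.symm h.1), hy.resolve_left (Ne.symm h.2)⟩
  by_cases z1 : z ∈ s(a, b) <;> by_cases z2 : z ∈ s(c, d)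
  · exact two a ha b hb c hc d hd e he f hf hab hcd hef h1 z1 z2 m m1 m2 m3
  all_goals by_cases z3 : z ∈ s(e, f)
  · obtain ⟨v, v1, v2, v3⟩ := two a ha b hb e he f hf c hc d hd hab hef hcd h2 z1 z3 m m1 m3 m2
    exact ⟨v, v1, v3, v2⟩
  · obtain ⟨c', d'⟩ := old c hc d hd z2
    obtain ⟨e', f'⟩ := old e he f hf z3
    exact one a ha b hb c c' d d' e e' f f' hab hcd hef h3 z1 m m1 m2 m3
  · obtain ⟨v, v1, v2, v3⟩ := two c hc d hd e he f hf a ha b hb hcd hef hab h3 z2 z3 m m2 m3 m1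
    exact ⟨v, v3, v1, v2⟩
  · obtain ⟨a', b'⟩ := old a ha b hb z1
    obtain ⟨e', f'⟩ := old e he f hf z3
    obtain ⟨v, v1, v2, v3⟩ := one c hc d hd a a' b b' e e' f f' hcd hab hef h2 z2 m m2 m1 m3
    exact ⟨v, v2, v1, v3⟩
  · obtain ⟨a', b'⟩ := old a ha b hb z1
    obtain ⟨c', d'⟩ := old c hc d hd z2
    obtain ⟨v, v1, v2, v3⟩ := one e he f hf a a' b b' c c' d d' hef hab hcd h1 z3 m m3 m1 m2
    exact ⟨v, v2, v3, v1⟩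
  · obtain ⟨a', b'⟩ := old a ha b hb z1
    obtain ⟨c', d'⟩ := old c hc d hd z2
    obtain ⟨e', f'⟩ := old e he f hf z3
    exact hS.2 a a' b b' c c' d d' e e' f f' hab hcd hef h1 h2 h3 ⟨m, ⟨m1, m2⟩, m3⟩

theorem generalPosition_empty : GeneralPosition ∅ := by
  constructor <;> intro a ha <;> exact ha.elim

/-- Injective families of points in general position are dense. -/
theorem dense_injective_generalPosition (α : Type*) [Finite α] :
    Dense {r : α → Plane | Function.Injective r ∧ GeneralPosition (range r)} := by
  classical
  have := Fintype.ofFinite α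
  rw [Metric.dense_iff]
  intro r₀ δ hδ
  have key : ∀ s : Finset α, ∃ r : α → Plane, (∀ x, dist (r x) (r₀ x) < δ) ∧ InjOn r s ∧
      GeneralPosition (r '' s) := by
    intro s
    induction s using Finset.induction_on with
    | empty => exact ⟨r₀, by simp [hδ], by simp, by simpa using generalPosition_empty⟩
    | insert x s hx ih =>
      obtain ⟨r, hr, hinj, hgp⟩ := ih
      have hfin : (r '' s).Finite := s.finite_toSet.image r
      have hN : NoThreeCollinear (r '' s) := hgp.1
      obtain ⟨z, hz, hzδ⟩ := (dense_compl_lines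
        (hfin.union (hN.finite_segmentCrossings hfin))).exists_dist_lt (r₀ x) hδ
      have himg : Function.update r x z '' s = r '' s := image_congr fun y hy =>
        Function.update_of_ne (by rintro rfl; exact hx hy) _ _
      refine ⟨Function.update r x z, fun y => ?_, ?_, ?_⟩
      · by_cases hy : y = x
        · subst hy
          simpa [dist_comm] using hzδ
        · simpa [hy] using hr y
      · rw [Finset.coe_insert, injOn_insert (by simpa using hx)]
        refine ⟨fun a ha b hb hab => ?_, ?_⟩
        · rw [Function.update_of_ne (by rintro rfl; exact hx ha),
            Function.update_of_ne (by rintro rfl; exact hx hb)] at hab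
          exact hinj ha hb hab
        · rw [himg, Function.update_self]
          intro h
          exact hz z (.inl h) z (.inl h) (left_mem_affineSpan_pair ℝ z z)
      · rw [Finset.coe_insert, image_insert_eq, Function.update_self, himg]
        exact hgp.insert hz
  obtain ⟨r, hr, hinj, hgp⟩ := key Finset.univ
  refine ⟨r, (dist_pi_lt_iff hδ).2 hr, ?_, ?_⟩
  · simpa using hinj
  · simpa using hgp

/-! ### Replacing a point by a small copy of a configuration -/

/-- The complement is the projection of a closed set along the compact square of segment parameters,
hence closed. -/
theorem isOpen_disjoint_segment {α : Type*} (a b c d : α) :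
    IsOpen {r : α → Plane | Disjoint (segment ℝ (r a) (r b)) (segment ℝ (r c) (r d))} := by
  rw [← isClosed_compl_iff]
  have hcl : IsClosed {w : (Icc (0 : ℝ) 1 × Icc (0 : ℝ) 1) × (α → Plane) |
      AffineMap.lineMap (w.2 a) (w.2 b) (w.1.1 : ℝ) =
        AffineMap.lineMap (w.2 c) (w.2 d) (w.1.2 : ℝ)} := by
    simp only [AffineMap.lineMap_apply_module]
    exact isClosed_eq (by fun_prop) (by fun_prop)
  convert isClosedMap_snd_of_compactSpace _ hcl using 1
  ext r
  simp only [mem_compl_iff, mem_ofPred_eq, not_disjoint_iff, segment_eq_image_lineMap, mem_image,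
    Prod.exists, exists_eq_right]
  constructor
  · rintro ⟨x, ⟨s, hs, rfl⟩, ⟨t, ht, h⟩⟩
    exact ⟨⟨s, hs⟩, ⟨t, ht⟩, h.symm⟩
  · rintro ⟨⟨s, hs⟩, ⟨t, ht⟩, h⟩
    exact ⟨_, ⟨s, hs, rfl⟩, ⟨t, ht, h.symm⟩⟩

/-- Disjointness of segments between points of a finite family persists under small changes. -/
theorem isOpen_disjoint_segments {α : Type*} [Finite α] (D : α → α → α → α → Prop) :
    IsOpen {r : α → Plane | ∀ a b c d, D a b c d →
      Disjoint (segment ℝ (r a) (r b)) (segment ℝ (r c) (r d))} := by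
  simp only [ofPred_forall]
  exact isOpen_iInter_of_finite fun a => isOpen_iInter_of_finite fun b =>
    isOpen_iInter_of_finite fun c => isOpen_iInter_of_finite fun d =>
    isOpen_iInter_of_finite fun _ => isOpen_disjoint_segment a b c d

/-- The point `p u` of a configuration `p` may be replaced by a small copy of a configuration `q`,
such that the result is in general position and no new crossings arise between segments which
had disjoint counterparts in `p` or in `q`. -/
theorem exists_blowup_configuration {α α' β : Type*} [Finite α] [Finite β] (π : α → α') (u : α')
    (σ : β → α) (hσ : Function.Injective σ) (hπσ : ∀ x, π x = u ↔ x ∈ range σ)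
    (p : α' → Plane) (q : β → Plane) :
    ∃ r : α → Plane, Function.Injective r ∧ GeneralPosition (range r) ∧
      (∀ a b c d, Disjoint (segment ℝ (p (π a)) (p (π b))) (segment ℝ (p (π c)) (p (π d))) →
        Disjoint (segment ℝ (r a) (r b)) (segment ℝ (r c) (r d))) ∧
      (∀ a b c d, Disjoint (segment ℝ (q a) (q b)) (segment ℝ (q c) (q d)) →
        Disjoint (segment ℝ (r (σ a)) (r (σ b))) (segment ℝ (r (σ c)) (r (σ d)))) := by
  classical
  let w : α → Plane := Function.extend σ q 0
  have hw : ∀ b, w (σ b) = q b := fun b => hσ.extend_apply q 0 b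
  -- At `ε = 0` this is `p ∘ π`, so disjointness in `p` persists for small `ε` by openness. For
  -- every `ε > 0` the fibre over `u` carries an affine copy of `q`.
  let r₀ : ℝ → α → Plane := fun ε x => p (π x) + ε • (if π x = u then w x else 0)
  have hr₀ : Continuous r₀ := by fun_prop
  have hO₁ := isOpen_disjoint_segments fun a b c d : α =>
    Disjoint (segment ℝ (p (π a)) (p (π b))) (segment ℝ (p (π c)) (p (π d)))
  have hO₂ := isOpen_disjoint_segments fun a b c d : α => ∃ a' b' c' d', a = σ a' ∧ b = σ b' ∧
    c = σ c' ∧ d = σ d' ∧ Disjoint (segment ℝ (q a') (q b')) (segment ℝ (q c') (q d'))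
  have hev : ∀ᶠ ε in 𝓝[>] (0 : ℝ), r₀ ε ∈ {r : α → Plane | ∀ a b c d,
      Disjoint (segment ℝ (p (π a)) (p (π b))) (segment ℝ (p (π c)) (p (π d))) →
      Disjoint (segment ℝ (r a) (r b)) (segment ℝ (r c) (r d))} := by
    refine nhdsWithin_le_nhds (hr₀.continuousAt.eventually (hO₁.mem_nhds ?_))
    intro a b c d h
    simpa [r₀] using h
  obtain ⟨ε, hε₁, hε⟩ := (hev.and self_mem_nhdsWithin).exists
  change 0 < ε at hε
  have hε₂ : r₀ ε ∈ {r : α → Plane | ∀ a b c d, (∃ a' b' c' d', a = σ a' ∧ b = σ b' ∧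
      c = σ c' ∧ d = σ d' ∧ Disjoint (segment ℝ (q a') (q b')) (segment ℝ (q c') (q d'))) →
      Disjoint (segment ℝ (r a) (r b)) (segment ℝ (r c) (r d))} := by
    rintro _ _ _ _ ⟨a, b, c, d, rfl, rfl, rfl, rfl, h⟩
    let φ : Plane →ᵃ[ℝ] Plane := AffineMap.const ℝ Plane (p u) + ε • AffineMap.id ℝ Plane
    have hφ : ∀ x, r₀ ε (σ x) = φ (q x) := by
      intro x
      have : π (σ x) = u := (hπσ _).2 ⟨x, rfl⟩
      simp [r₀, φ, this, hw]
    have hinj : Function.Injective φ := by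
      intro x y hxy
      simpa [φ, hε.ne'] using hxy
    simp only [hφ, ← image_segment]
    exact (disjoint_image_iff hinj).2 h
  -- Both disjointness conditions are open, so a further small perturbation reaches general position
  -- without losing them.
  obtain ⟨r, ⟨hr₁, hr₂⟩, hinj, hgp⟩ := (dense_injective_generalPosition α).inter_open_nonempty _
    (hO₁.inter hO₂) ⟨_, hε₁, hε₂⟩
  exact ⟨r, hinj, hgp, hr₁, fun a b c d h => hr₂ _ _ _ _ ⟨a, b, c, d, rfl, rfl, rfl, rfl, h⟩⟩

/-! ### Counting -/

theorem Set.ncard_biUnion_le_mul {ι α : Type*} {D : Set ι} (hD : D.Finite) {F : ι → Set α} {m : ℕ}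
    (hF : ∀ i ∈ D, (F i).ncard ≤ m) : (⋃ i ∈ D, F i).ncard ≤ D.ncard * m := by
  have h1 := hD.toFinset.set_ncard_biUnion_le F
  simp only [Finite.mem_toFinset] at h1
  refine h1.trans ?_
  rw [ncard_eq_toFinset_card D hD, ← smul_eq_mul]
  exact Finset.sum_le_card_nsmul _ _ _ fun i hi => hF i (hD.mem_toFinset.1 hi)

/-- Charges each pair to a member in `D`, which has at most `m` possible partners. -/
theorem Sym2.ncard_le_mul {E : Type*} [Finite E] {Z : Set (Sym2 E)} {D : Set E} {F : E → Set E}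
    {m : ℕ} (hF : ∀ e ∈ D, (F e).ncard ≤ m) (hZ : ∀ z ∈ Z, ∃ e ∈ D, ∃ f ∈ F e, z = s(e, f)) :
    Z.ncard ≤ D.ncard * m := by
  refine le_trans (ncard_le_ncard (t := ⋃ e ∈ D, (fun f => s(e, f)) '' F e) ?_ (toFinite _))
    (ncard_biUnion_le_mul (toFinite _) fun e he => (ncard_image_le (toFinite _)).trans (hF e he))
  intro z hz
  obtain ⟨e, he, f, hf, rfl⟩ := hZ z hz
  simp only [mem_iUnion]
  exact ⟨e, he, f, hf, rfl⟩

namespace Graph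

variable {α α' β E : Type*}

/-! ### Contraction of a set of vertices, and the part inside it -/

/-- The pairs of edges which have a common endpoint in `T`. -/
def pairsAt (Q : Graph α E) (T : Set α) : Set (Sym2 E) :=
  {z | ∃ e f, e ≠ f ∧ z = s(e, f) ∧ ∃ v ∈ T, Q.Inc e v ∧ Q.Inc f v}

/-- The multigraph obtained by mapping the vertices by `π` and deleting all loops at `u`. -/
def contract (M : Graph α E) (π : α → α') (u : α') : Graph α' E where
  vertexSet := univ
  IsLink e x y := ∃ x' y', M.IsLink e x' y' ∧ π x' = x ∧ π y' = y ∧ ¬ (x = u ∧ y = u)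
  isLink_symm := fun _ _ => ⟨fun _ _ ⟨x', y', h, hx, hy, hn⟩ =>
    ⟨y', x', h.symm, hy, hx, fun h' => hn h'.symm⟩⟩
  eq_or_eq_of_isLink_of_isLink := by
    rintro e _ _ _ _ ⟨x', y', h, rfl, rfl, -⟩ ⟨v', w', h', rfl, rfl, -⟩
    exact (h.left_eq_or_eq h').imp (congrArg π) (congrArg π)
  left_mem_of_isLink := fun _ _ _ _ => mem_univ _

/-- The multigraph induced along an injective map of vertices. -/
def pullback (M : Graph α E) (σ : β → α) (hσ : Function.Injective σ) : Graph β E where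
  vertexSet := univ
  IsLink e x y := M.IsLink e (σ x) (σ y)
  isLink_symm := fun _ _ => ⟨fun _ _ h => h.symm⟩
  eq_or_eq_of_isLink_of_isLink := fun _ _ _ _ _ h h' =>
    (h.left_eq_or_eq h').imp (fun h => hσ h) (fun h => hσ h)
  left_mem_of_isLink := fun _ _ _ _ => mem_univ _

section

variable {M : Graph α E} {π : α → α'} {u : α'} {σ : β → α} {hσ : Function.Injective σ}

theorem IsLink.contract {e : E} {x y : α} (h : M.IsLink e x y) (hn : ¬ (π x = u ∧ π y = u)) :
    (M.contract π u).IsLink e (π x) (π y) :=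
  ⟨x, y, h, rfl, rfl, hn⟩

theorem IsLink.mem_pullback (hπσ : ∀ x, π x = u ↔ x ∈ range σ) {e : E} {x y : α}
    (h : M.IsLink e x y) (hx : π x = u) (hy : π y = u) : e ∈ (M.pullback σ hσ).edgeSet := by
  obtain ⟨x, rfl⟩ := (hπσ _).1 hx
  obtain ⟨y, rfl⟩ := (hπσ _).1 hy
  exact ⟨x, y, h⟩

theorem Inc.mem_pullback_or_contract (hπσ : ∀ x, π x = u ↔ x ∈ range σ) {e : E} {x : α}
    (h : M.Inc e x) : e ∈ (M.pullback σ hσ).edgeSet ∨ (M.contract π u).Inc e (π x) := by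
  obtain ⟨y, h⟩ := h
  by_cases hn : π x = u ∧ π y = u
  · exact .inl (h.mem_pullback hπσ hn.1 hn.2)
  · exact .inr ⟨_, h.contract hn⟩

/-- An edge inside the fibre over `u` becomes a deleted loop of the contraction, so no edge is
counted twice. -/
theorem numEdges_contract_add_pullback_le [Finite E] (hπσ : ∀ x, π x = u ↔ x ∈ range σ) :
    (M.contract π u).numEdges + (M.pullback σ hσ).numEdges ≤ M.numEdges := by
  unfold numEdges
  rw [← ncard_union_eq _ (toFinite _) (toFinite _)]
  · refine ncard_le_ncard ?_ (toFinite _)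
    rintro e (⟨_, _, x, y, h, -⟩ | ⟨x, y, h⟩)
    exacts [h.edge_mem, IsLink.edge_mem h]
  · rw [disjoint_left]
    rintro e ⟨_, _, x, y, h, rfl, rfl, hn⟩ ⟨a, b, hab⟩
    have ha : π (σ a) = u := (hπσ _).2 ⟨a, rfl⟩
    have hb : π (σ b) = u := (hπσ _).2 ⟨b, rfl⟩
    rcases h.eq_and_eq_or_eq_and_eq hab with ⟨rfl, rfl⟩ | ⟨rfl, rfl⟩
    exacts [hn ⟨ha, hb⟩, hn ⟨hb, ha⟩]

theorem crossingPairs_subset (hπσ : ∀ x, π x = u ↔ x ∈ range σ)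
    (hπ : ∀ x y, π x = π y → π x ≠ u → x = y) (hM : ∀ e x, ¬ M.IsLink e x x)
    {p : α' → Plane} (hp : Function.Injective p) (hgp : NoThreeCollinear (range p))
    {q : β → Plane} {r : α → Plane}
    (h₁ : ∀ a b c d, Disjoint (segment ℝ (p (π a)) (p (π b))) (segment ℝ (p (π c)) (p (π d))) →
        Disjoint (segment ℝ (r a) (r b)) (segment ℝ (r c) (r d)))
    (h₂ : ∀ a b c d, Disjoint (segment ℝ (q a) (q b)) (segment ℝ (q c) (q d)) →
        Disjoint (segment ℝ (r (σ a)) (r (σ b))) (segment ℝ (r (σ c)) (r (σ d)))) :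
    M.crossingPairs r ⊆ (M.contract π u).crossingPairs p ∪ (M.contract π u).pairsAt {u} ∪
      (M.pullback σ hσ).crossingPairs q ∪
      {z | ∃ e ∈ (M.pullback σ hσ).edgeSet, ∃ f, (M.contract π u).Inc f u ∧ z = s(e, f)} := by
  have inside : ∀ e f a b c d, M.IsLink e a b → M.IsLink f c d → a ≠ c → a ≠ d → b ≠ c → b ≠ d →
      (segment ℝ (r a) (r b) ∩ segment ℝ (r c) (r d)).Nonempty → π a = u → π b = u →
      (M.pullback σ hσ).Crosses q e f ∨
        e ∈ (M.pullback σ hσ).edgeSet ∧ (M.contract π u).Inc f u := by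
    intro e f a b c d he hf hac had hbc hbd hx ha hb
    by_cases hc : π c = u <;> by_cases hd : π d = u
    · left
      obtain ⟨a, rfl⟩ := (hπσ _).1 ha
      obtain ⟨b, rfl⟩ := (hπσ _).1 hb
      obtain ⟨c, rfl⟩ := (hπσ _).1 hc
      obtain ⟨d, rfl⟩ := (hπσ _).1 hd
      refine ⟨a, b, c, d, he, hf, ne_of_apply_ne σ hac, ne_of_apply_ne σ had,
        ne_of_apply_ne σ hbc, ne_of_apply_ne σ hbd, ?_⟩
      exact not_disjoint_iff_nonempty_inter.1
        (mt (h₂ a b c d) (not_disjoint_iff_nonempty_inter.2 hx))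
    · exact .inr ⟨he.mem_pullback hπσ ha hb, hc ▸ (hf.contract fun h => hd (h.2.trans hc)).inc_left⟩
    · exact .inr ⟨he.mem_pullback hπσ ha hb, hd ▸ (hf.contract fun h => hc (h.1.trans hd)).inc_right⟩
    -- An edge inside the fibre is near `p u`, and `p u` is off the segment of an edge avoiding `u`
    -- because no three points of `p` are collinear.
    · exfalso
      refine not_disjoint_iff_nonempty_inter.2 hx (h₁ a b c d ?_)
      have hcd : π c ≠ π d := fun h => hM f c (by
        have := hπ c d h hc
        subst this
        exact hf)
      rw [ha, hb, segment_same, disjoint_singleton_left]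
      intro h
      rcases hgp.eq_or_eq_of_mem_segment (mem_range_self _) (mem_range_self _) (mem_range_self _)
        (hp.ne hcd) h with h | h
      exacts [hc (hp h).symm, hd (hp h).symm]
  rintro z ⟨e, f, rfl, a, b, c, d, he, hf, hac, had, hbc, hbd, hx⟩
  by_cases hab : π a = u ∧ π b = u
  · rcases inside e f a b c d he hf hac had hbc hbd hx hab.1 hab.2 with h | h
    · exact .inl (.inr ⟨e, f, rfl, h⟩)
    · exact .inr ⟨e, h.1, f, h.2, rfl⟩
  by_cases hcd : π c = u ∧ π d = u
  · rcases inside f e c d a b hf he hac.symm hbc.symm had.symm hbd.symm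
      (by rwa [inter_comm]) hcd.1 hcd.2 with h | h
    · exact .inl (.inr ⟨f, e, Sym2.eq_swap, h⟩)
    · exact .inr ⟨f, h.1, e, h.2, Sym2.eq_swap⟩
  refine .inl (.inl ?_)
  have he' := he.contract hab
  have hf' := hf.contract hcd
  -- If both edges reach the fibre, `p` gives no information: they meet at `u` in the contraction
  -- and are covered by `pairsAt`. Otherwise their ends stay distinct and the crossing is already
  -- present in `p`.
  by_cases hu : (π a = u ∨ π b = u) ∧ (π c = u ∨ π d = u)
  · right
    refine ⟨e, f, ?_, rfl, u, rfl, ?_, ?_⟩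
    · rintro rfl
      rcases he.left_eq_or_eq hf with h | h
      exacts [hac h, had h]
    · rcases hu.1 with h | h
      exacts [h ▸ he'.inc_left, h ▸ he'.inc_right]
    · rcases hu.2 with h | h
      exacts [h ▸ hf'.inc_left, h ▸ hf'.inc_right]
  · left
    have hne : ∀ x y, (π x ≠ u ∨ π y ≠ u) → x ≠ y → π x ≠ π y := by
      intro x y hxy hn h
      exact hn (hπ x y h (by grind))
    refine ⟨e, f, rfl, _, _, _, _, he', hf', hne a c (by grind) hac, hne a d (by grind) had,
      hne b c (by grind) hbc, hne b d (by grind) hbd, ?_⟩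
    exact not_disjoint_iff_nonempty_inter.1
      (mt (h₁ a b c d) (not_disjoint_iff_nonempty_inter.2 hx))

theorem pairsAt_subset (hπσ : ∀ x, π x = u ↔ x ∈ range σ) {T : Set α} {T' : Set α'}
    (hT : ∀ x ∈ T, π x ∈ T') :
    M.pairsAt T ⊆ (M.contract π u).pairsAt T' ∪
      {z | ∃ e ∈ (M.pullback σ hσ).edgeSet, ∃ f,
        (∃ v ∈ T, M.Inc e v ∧ M.Inc f v) ∧ z = s(e, f)} := by
  rintro z ⟨e, f, hef, rfl, v, hv, he, hf⟩
  rcases he.mem_pullback_or_contract (hσ := hσ) hπσ with he' | he'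
  · exact .inr ⟨e, he', f, ⟨v, hv, he, hf⟩, rfl⟩
  rcases hf.mem_pullback_or_contract (hσ := hσ) hπσ with hf' | hf'
  · exact .inr ⟨f, hf', e, ⟨v, hv, hf, he⟩, Sym2.eq_swap⟩
  · exact .inl ⟨e, f, hef, rfl, π v, hT v hv, he', hf'⟩

theorem degree_pullback_le [Finite E] (x : β) :
    (M.pullback σ hσ).degree x ≤ M.degree (σ x) := by
  refine ncard_le_ncard ?_ (toFinite _)
  rintro e ⟨y, h⟩
  exact ⟨_, h⟩

theorem degree_contract_le [Finite E] (hπ : ∀ x y, π x = π y → π x ≠ u → x = y) (x : α)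
    (hx : π x ≠ u) : (M.contract π u).degree (π x) ≤ M.degree x := by
  refine ncard_le_ncard ?_ (toFinite _)
  rintro e ⟨_, x', y', h, hx', -⟩
  obtain rfl := hπ x x' hx'.symm hx
  exact ⟨_, h⟩

end

/-- A rectilinear drawing with the minimum number of crossing-pairs exists. -/
theorem exists_minimal_drawing [Finite α] (Q : Graph α E) (hQ : Q.vertexSet = univ) :
    ∃ p : α → Plane, Function.Injective p ∧ GeneralPosition (range p) ∧
      (Q.crossingPairs p).ncard = Q.rectilinearCrossingNumber := by
  have hne : {n | ∃ p : α → Plane, Q.IsRectilinearDrawing p ∧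
      n = (Q.crossingPairs p).ncard}.Nonempty := by
    obtain ⟨r, hr, hgp⟩ := (dense_injective_generalPosition α).nonempty
    exact ⟨_, r, ⟨hr.injOn, by rwa [hQ, image_univ]⟩, rfl⟩
  obtain ⟨p, ⟨hinj, hgp⟩, h⟩ := Nat.sInf_mem hne
  rw [hQ, image_univ] at hgp
  rw [hQ, injOn_univ] at hinj
  exact ⟨p, hinj, hgp, h.symm⟩

theorem maxDegree_le {Q : Graph α E} {m : ℕ} (h : ∀ v, Q.degree v ≤ m) : Q.maxDegree ≤ m :=
  ciSup_le' fun v => h v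

end Graph

/-! ### Degrees in simplicial blowups -/

namespace SimpleGraph.IsSimplicialBlowup

variable {V S E : Type*} {k : ℕ} {G : SimpleGraph V} {M : Graph (V ⊕ S) E}

theorem not_isLink_inr_inr (hM : IsSimplicialBlowup k G M) (e : E) (u v : S) :
    ¬ M.IsLink e (Sum.inr u) (Sum.inr v) := by
  obtain ⟨-, K, -, h, -⟩ := hM
  exact h e u v

theorem not_isLink_self (hM : IsSimplicialBlowup k G M) (e : E) (x : V ⊕ S) :
    ¬ M.IsLink e x x := by
  rcases x with x | x
  · obtain ⟨-, K, -, -, -, h, -⟩ := hM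
    exact fun hl => G.loopless.irrefl _ (h e x x hl)
  · exact hM.not_isLink_inr_inr e x x

theorem degree_inr_le [Finite V] [Finite E] (hM : IsSimplicialBlowup k G M) {Δ : ℕ}
    (hΔ : ∀ v, M.degree (Sum.inl v) ≤ Δ) (u : S) : M.degree (Sum.inr u) ≤ k * Δ := by
  obtain ⟨-, K, hK, hind, hadj, -⟩ := hM
  have h1 : M.degree (Sum.inr u) ≤ (⋃ v ∈ K u, {e | M.Inc e (Sum.inl v)}).ncard := by
    refine ncard_le_ncard ?_ (toFinite _)
    rintro e ⟨x | x, hx⟩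
    · simp only [mem_iUnion]
      exact ⟨x, (hadj u x).1 ⟨e, hx.symm⟩, _, hx.symm⟩
    · exact (hind _ _ _ hx).elim
  exact h1.trans ((ncard_biUnion_le_mul (toFinite _) fun v _ => hΔ v).trans
    (Nat.mul_le_mul_right _ (hK u).2))

theorem degree_le [Finite V] [Finite E] (hM : IsSimplicialBlowup k G M) (hk : 1 ≤ k) {Δ : ℕ}
    (hΔ : ∀ v, M.degree (Sum.inl v) ≤ Δ) (x : V ⊕ S) : M.degree x ≤ k * Δ := by
  rcases x with v | u
  · exact (hΔ v).trans (Nat.le_mul_of_pos_left _ hk)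
  · exact hM.degree_inr_le hΔ u

/-- New vertices are independent, so `e` has at most one new endpoint, whose degree is at most `k *
Δ`. -/
theorem ncard_edges_sharing_inr_le [Finite V] [Finite E] (hM : IsSimplicialBlowup k G M) {Δ : ℕ}
    (hΔ : ∀ v, M.degree (Sum.inl v) ≤ Δ) (e : E) :
    {f | ∃ v ∈ range Sum.inr, M.Inc e v ∧ M.Inc f v}.ncard ≤ k * Δ := by
  by_cases he : ∃ u, M.Inc e (Sum.inr u)
  · obtain ⟨u, hu⟩ := he
    refine (ncard_le_ncard ?_ (toFinite _)).trans (hM.degree_inr_le hΔ u)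
    rintro f ⟨_, ⟨v, rfl⟩, hv, hf⟩
    obtain ⟨x, hx⟩ := hu
    rcases hv.eq_or_eq_of_isLink hx with h | rfl
    · rwa [h] at hf
    · exact (hM.not_isLink_inr_inr _ _ _ hx).elim
  · convert Nat.zero_le _
    rw [ncard_eq_zero (toFinite _), eq_empty_iff_forall_notMem]
    rintro f ⟨_, ⟨v, rfl⟩, hv, -⟩
    exact he ⟨v, hv⟩

end SimpleGraph.IsSimplicialBlowup

/-! ### Induction along clique-sums -/

namespace SimpleGraph

/-- Every `(≤ k)`-simplicial blowup of `H` in which the old vertices have degree at most `Δ` has a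
rectilinear drawing with at most `k (c + 2) Δ ‖M‖` pairs of edges which cross or meet in a new
vertex. -/
def HasBlowupDrawings {V : Type u} (k : ℕ) (c : ℝ) (H : SimpleGraph V) : Prop :=
  ∀ (S E : Type u) [Finite S] [Finite E] (M : Graph (V ⊕ S) E), IsSimplicialBlowup k H M →
    ∀ Δ : ℕ, (∀ v, M.degree (Sum.inl v) ≤ Δ) →
      ∃ p : V ⊕ S → Plane, Function.Injective p ∧ GeneralPosition (range p) ∧
        ((M.crossingPairs p ∪ M.pairsAt (range Sum.inr)).ncard : ℝ) ≤
          k * (c + 2) * Δ * M.numEdges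

theorem Agreeable.exists_drawing {W : Type u} [Finite W] {k : ℕ} {c : ℝ} (hc : 0 < c)
    {P : SimpleGraph W} (hP : P.Agreeable k c) (U : Set W) (S E : Type u) [Finite S] [Finite E]
    (Q : Graph (U ⊕ S) E) (hQ : IsSimplicialBlowup k (P.induce U) Q) {Δ : ℕ}
    (hΔ : ∀ v, Q.degree v ≤ k * Δ) :
    ∃ q : U ⊕ S → Plane, Function.Injective q ∧ GeneralPosition (range q) ∧
      ((Q.crossingPairs q).ncard : ℝ) ≤ c * (k * Δ : ℕ) * Q.numEdges := by
  obtain ⟨q, hq, hgp, hcr⟩ := Q.exists_minimal_drawing hQ.1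
  refine ⟨q, hq, hgp, hcr ▸ (hP U S E Q hQ).trans ?_⟩
  have : (Q.maxDegree : ℝ) ≤ (k * Δ : ℕ) := by exact_mod_cast Graph.maxDegree_le hΔ
  gcongr

/-- Base case: crossings cost `c * k * Δ` per edge and pairs at new vertices `k * Δ`, so even the
factor `c + 1` would do. -/
theorem Agreeable.hasBlowupDrawings {W V : Type u} [Finite W] {k : ℕ} (hk : 1 ≤ k) {c : ℝ}
    (hc : 0 < c) {P : SimpleGraph W} (hP : P.Agreeable k c) {G : SimpleGraph V} (φ : P ≃g G) :
    G.HasBlowupDrawings k c := by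
  intro S E _ _ M hM Δ hΔ
  have : Finite V := Finite.of_equiv W φ.toEquiv
  have hdeg := hM.degree_le hk hΔ
  let ψ : (univ : Set W) ⊕ S ≃ V ⊕ S :=
    Equiv.sumCongr ((Equiv.Set.univ W).trans φ.toEquiv) (Equiv.refl S)
  have hψl : ∀ v, ψ (Sum.inl v) = Sum.inl (φ v.1) := fun _ => rfl
  have hψr : ∀ s, ψ (Sum.inr s) = Sum.inr s := fun _ => rfl
  have hQ : IsSimplicialBlowup k (P.induce univ) (M.pullback ψ ψ.injective) := by
    obtain ⟨hV, K, hK, hind, hadj, hlink, hsimp, hmiss⟩ := hM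
    refine ⟨rfl, fun s => (fun v : (univ : Set W) => φ v.1) ⁻¹' K s, fun u => ⟨?_, ?_⟩,
      fun e u v => hind e u v, fun u v => hadj u (φ v.1), fun e a b h => ?_,
      fun e f a b => hsimp e f _ _, fun a b hab h => ?_⟩
    · intro a ha b hb hab
      exact φ.map_adj_iff.1 ((hK u).1 ha hb fun h => hab (Subtype.ext (φ.injective h)))
    · refine le_trans ?_ (hK u).2
      rw [← ncard_image_of_injective _ (f := fun v : (univ : Set W) => φ v.1)
        (φ.injective.comp Subtype.val_injective)]
      exact ncard_le_ncard (image_preimage_subset _ _) (toFinite _)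
    · exact φ.map_adj_iff.1 (hlink e _ _ h)
    · exact hmiss _ _ (φ.map_adj_iff.2 hab) h
  obtain ⟨q, hq, hgp, hcr⟩ := hP.exists_drawing hc univ S E _ hQ (Δ := Δ)
    fun v => Graph.degree_pullback_le v |>.trans (hdeg _)
  refine ⟨q ∘ ψ.symm, hq.comp ψ.symm.injective, ?_, ?_⟩
  · rwa [ψ.symm.surjective.range_comp]
  have h1 : M.crossingPairs (q ∘ ψ.symm) ⊆ (M.pullback ψ ψ.injective).crossingPairs q := by
    rintro z ⟨e, f, rfl, a, b, c, d, he, hf, h⟩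
    refine ⟨e, f, rfl, ψ.symm a, ψ.symm b, ψ.symm c, ψ.symm d, ?_, ?_, ?_⟩
    · simpa [Graph.pullback] using he
    · simpa [Graph.pullback] using hf
    · simpa using h
  have h2 : (M.pullback ψ ψ.injective).numEdges ≤ M.numEdges := by
    refine ncard_le_ncard ?_ (toFinite _)
    rintro e ⟨x, y, h⟩
    exact Graph.IsLink.edge_mem h
  have h3 : (M.pairsAt (range Sum.inr)).ncard ≤ M.numEdges * (k * Δ) := by
    refine Sym2.ncard_le_mul (fun e _ => hM.ncard_edges_sharing_inr_le hΔ e) ?_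
    rintro z ⟨e, f, -, rfl, v, hv, he, hf⟩
    exact ⟨e, he.edge_mem, f, ⟨v, hv, he, hf⟩, rfl⟩
  have h4 := (ncard_union_le (M.crossingPairs (q ∘ ψ.symm)) (M.pairsAt (range Sum.inr))).trans
    (add_le_add (ncard_le_ncard h1 (toFinite _)) h3)
  have h4' : ((M.crossingPairs (q ∘ ψ.symm) ∪ M.pairsAt (range Sum.inr)).ncard : ℝ) ≤
      ((M.pullback ψ ψ.injective).crossingPairs q).ncard + M.numEdges * (k * Δ) := by
    exact_mod_cast h4
  have h2' : ((M.pullback ψ ψ.injective).numEdges : ℝ) ≤ M.numEdges := by exact_mod_cast h2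
  have h5 : c * (k * Δ : ℕ) * (M.pullback ψ ψ.injective).numEdges ≤
      c * (k * Δ : ℕ) * M.numEdges := by gcongr
  push_cast at h5 hcr
  have h6 : (0 : ℝ) ≤ M.numEdges * (k * Δ) := by positivity
  linarith

/-- Induction step: contract the side of `P`, draw both parts, and insert one drawing into the
other. -/
theorem HasBlowupDrawings.cliqueSum {A B V : Type u} [Finite V] {k : ℕ} (hk : 1 ≤ k) {c : ℝ}
    (hc : 0 < c) {H : SimpleGraph A} (hH : H.HasBlowupDrawings k c) {P : SimpleGraph B}
    (hP : P.Agreeable k c) {G : SimpleGraph V} (hG : IsCliqueSum k H P G) :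
    G.HasBlowupDrawings k c := by
  classical
  intro S E _ _ M hM Δ hΔ
  have hM₀ := hM
  obtain ⟨hV, K, hK, hind, hadj, hlink, hsimp, hmiss⟩ := hM
  obtain ⟨f, g, C, hcov, hC, -, hCk, hHC, hPC, hsub, hdel⟩ := hG
  have : Finite A := Finite.of_injective f f.injective
  have : Finite B := Finite.of_injective g g.injective
  have hsub' : ∀ x y, G.Adj x y →
      (∃ a a', H.Adj a a' ∧ f a = x ∧ f a' = y) ∨ (∃ b b', P.Adj b b' ∧ g b = x ∧ g b' = y) := by
    intro x y h
    simpa [map_adj] using hsub x y h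
  have hGH : ∀ a a', G.Adj (f a) (f a') → H.Adj a a' := by
    intro a a' h
    rcases hsub' _ _ h with ⟨x, y, hxy, hx, hy⟩ | ⟨x, y, hxy, hx, hy⟩
    · rwa [← f.injective hx, ← f.injective hy]
    · refine hHC (?_ : f a ∈ C) (?_ : f a' ∈ C) fun h' => h.ne (congrArg f h')
      · rw [hC]; exact ⟨⟨a, rfl⟩, ⟨x, hx⟩⟩
      · rw [hC]; exact ⟨⟨a', rfl⟩, ⟨y, hy⟩⟩
  have hGP : ∀ b b', G.Adj (g b) (g b') → P.Adj b b' := by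
    intro b b' h
    rcases hsub' _ _ h with ⟨x, y, hxy, hx, hy⟩ | ⟨x, y, hxy, hx, hy⟩
    · refine hPC (?_ : g b ∈ C) (?_ : g b' ∈ C) fun h' => h.ne (congrArg g h')
      · rw [hC]; exact ⟨⟨x, hx⟩, ⟨b, rfl⟩⟩
      · rw [hC]; exact ⟨⟨y, hy⟩, ⟨b', rfl⟩⟩
    · rwa [← g.injective hx, ← g.injective hy]
  have hGC : ∀ a v, v ∉ range f → G.Adj (f a) v → f a ∈ C := by
    intro a v hv h
    rcases hsub' _ _ h with ⟨x, y, hxy, hx, hy⟩ | ⟨x, y, hxy, hx, hy⟩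
    · exact (hv ⟨y, hy⟩).elim
    · rw [hC]; exact ⟨⟨a, rfl⟩, ⟨x, hx⟩⟩
  have hCf : ∀ v, v ∉ range f → v ∉ C := fun v hv h => hv (by rw [hC] at h; exact h.1)
  have hPG : ∀ x y, y ∉ C → (P.map g).Adj x y → G.Adj x y := by
    intro x y hy h
    by_contra hn
    exact hy (hdel x y (Or.inr h) hn).2.1
  -- the vertices outside `H`, and the new vertices attached to them, are contracted
  let π : V ⊕ S → A ⊕ Option {s // K s ⊆ range f} := Sum.elim
    (fun v => if h : v ∈ range f then Sum.inl h.choose else Sum.inr none)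
    (fun s => if h : K s ⊆ range f then Sum.inr (some ⟨s, h⟩) else Sum.inr none)
  have hπf : ∀ a, π (Sum.inl (f a)) = Sum.inl a := by
    intro a
    have h : f a ∈ range f := ⟨a, rfl⟩
    simp only [π, Sum.elim_inl, dif_pos h]
    exact congrArg _ (f.injective h.choose_spec)
  have hπv : ∀ v, v ∉ range f → π (Sum.inl v) = Sum.inr none := by
    intro v h
    simp only [π, Sum.elim_inl, dif_neg h]
  have hπs : ∀ s (h : K s ⊆ range f), π (Sum.inr s) = Sum.inr (some ⟨s, h⟩) := by
    intro s h
    simp only [π, Sum.elim_inr, dif_pos h]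
  have hπs' : ∀ s, ¬ K s ⊆ range f → π (Sum.inr s) = Sum.inr none := by
    intro s h
    simp only [π, Sum.elim_inr, dif_neg h]
  have hcases : ∀ x, (∃ a, x = Sum.inl (f a)) ∨ (∃ v, v ∉ range f ∧ x = Sum.inl v) ∨
      (∃ s, K s ⊆ range f ∧ x = Sum.inr s) ∨ (∃ s, ¬ K s ⊆ range f ∧ x = Sum.inr s) := by
    rintro (v | s)
    · by_cases h : v ∈ range f
      · obtain ⟨a, rfl⟩ := h
        exact .inl ⟨a, rfl⟩
      · exact .inr (.inl ⟨v, h, rfl⟩)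
    · by_cases h : K s ⊆ range f
      · exact .inr (.inr (.inl ⟨s, h, rfl⟩))
      · exact .inr (.inr (.inr ⟨s, h, rfl⟩))
  have hπinl : ∀ x a, π x = Sum.inl a ↔ x = Sum.inl (f a) := by
    intro x a
    refine ⟨fun h => ?_, fun h => h ▸ hπf a⟩
    rcases hcases x with ⟨a', rfl⟩ | ⟨v, hv, rfl⟩ | ⟨s, hs, rfl⟩ | ⟨s, hs, rfl⟩
    · rw [hπf] at h
      rw [Sum.inl.inj h]
    · simp [hπv v hv] at h
    · simp [hπs s hs] at h
    · simp [hπs' s hs] at h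
  have hπsome : ∀ x s, π x = Sum.inr (some s) ↔ x = Sum.inr s.1 := by
    intro x s
    refine ⟨fun h => ?_, fun h => h ▸ hπs s.1 s.2⟩
    rcases hcases x with ⟨a', rfl⟩ | ⟨v, hv, rfl⟩ | ⟨s, hs, rfl⟩ | ⟨s, hs, rfl⟩
    · simp [hπf] at h
    · simp [hπv v hv] at h
    · rw [hπs s hs] at h
      rw [← Option.some.inj (Sum.inr.inj h)]
    · simp [hπs' s hs] at h
  have hπ : ∀ x y, π x = π y → π x ≠ Sum.inr none → x = y := by
    intro x y hxy hx
    rcases h : π x with a | _ | s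
    · rw [(hπinl x a).1 h, (hπinl y a).1 (hxy ▸ h)]
    · exact (hx h).elim
    · rw [(hπsome x s).1 h, (hπsome y s).1 (hxy ▸ h)]
  -- Only the vertices of `P` outside the shared clique are contracted, which is why agreeability
  -- must cover induced subgraphs.
  let U : Set B := {b | g b ∉ range f}
  let σ : U ⊕ {s // ¬ K s ⊆ range f} → V ⊕ S := Sum.map (fun b => g b.1) Subtype.val
  have hσ : Function.Injective σ :=
    Function.Injective.sumMap (g.injective.comp Subtype.val_injective) Subtype.val_injective
  have hgU : ∀ v, v ∉ range f → ∃ b : U, g b.1 = v := by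
    intro v hv
    have h : v ∈ range f ∪ range g := hcov.symm ▸ mem_univ v
    obtain ⟨b, rfl⟩ := h.resolve_left hv
    exact ⟨⟨b, hv⟩, rfl⟩
  have hπσ : ∀ x, π x = Sum.inr none ↔ x ∈ range σ := by
    intro x
    constructor
    · intro h
      rcases hcases x with ⟨a', rfl⟩ | ⟨v, hv, rfl⟩ | ⟨s, hs, rfl⟩ | ⟨s, hs, rfl⟩
      · simp [hπf] at h
      · obtain ⟨b, rfl⟩ := hgU v hv
        exact ⟨Sum.inl b, rfl⟩
      · simp [hπs s hs] at h
      · exact ⟨Sum.inr ⟨s, hs⟩, rfl⟩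
    · rintro ⟨b | s, rfl⟩
      · exact hπv _ b.2
      · exact hπs' _ s.2
  -- a vertex of `H` with an edge into the contracted part belongs to `C`
  have hclC : ∀ a s, f a ∈ K s → ¬ K s ⊆ range f → f a ∈ C := by
    intro a s ha hs
    obtain ⟨z, hz, hzf⟩ := not_subset.1 hs
    exact hGC a z hzf ((hK s).1 ha hz fun h => hzf ⟨a, h⟩)
  have htoC : ∀ e a y, M.IsLink e (Sum.inl (f a)) y → π y = Sum.inr none → f a ∈ C := by
    intro e a y he hy
    rcases hcases y with ⟨a', rfl⟩ | ⟨v, hv, rfl⟩ | ⟨s, hs, rfl⟩ | ⟨s, hs, rfl⟩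
    · simp [hπf] at hy
    · exact hGC a v hv (hlink _ _ _ he)
    · simp [hπs s hs] at hy
    · exact hclC a s ((hadj s _).1 ⟨e, he⟩) hs
  -- `none` is the contracted vertex. Its neighbours lie in `C`, hence form a clique of `H` of size
  -- at most `k`.
  let K' : Option {s // K s ⊆ range f} → Set A := fun o =>
    o.elim {a | ∃ e y, M.IsLink e (Sum.inl (f a)) y ∧ π y = Sum.inr none} fun s => f ⁻¹' K s.1
  have hM' : IsSimplicialBlowup k H (M.contract π (Sum.inr none)) := by
    have hll : ∀ e a b, (M.contract π (Sum.inr none)).IsLink e (Sum.inl a) (Sum.inl b) ↔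
        M.IsLink e (Sum.inl (f a)) (Sum.inl (f b)) := by
      intro e a b
      constructor
      · rintro ⟨x, y, h, hx, hy, -⟩
        rwa [(hπinl _ _).1 hx, (hπinl _ _).1 hy] at h
      · exact fun h => ⟨_, _, h, hπf a, hπf b, by simp⟩
    -- If the edge to `z` is missing in `M`, some new vertex `s` is attached to both its ends. As
    -- `z` lies outside `H`, `s` is contracted too and provides the required edge.
    have hdirect : ∀ a z, z ∉ C → (P.map g).Adj (f a) z → a ∈ K' none := by
      intro a z hzC haz
      have hz : z ∉ range f := by
        intro hzf
        obtain ⟨b, b', -, -, hb'⟩ := (map_adj _ _ _ _).1 haz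
        exact hzC (by rw [hC]; exact ⟨hzf, ⟨b', hb'⟩⟩)
      have hGaz := hPG _ _ hzC haz
      by_cases hl : ∃ e, M.IsLink e (Sum.inl (f a)) (Sum.inl z)
      · obtain ⟨e, he⟩ := hl
        exact ⟨e, _, he, hπv z hz⟩
      · obtain ⟨s, has, hzs⟩ := hmiss _ _ hGaz (not_exists.1 hl)
        obtain ⟨e, he⟩ := (hadj s _).2 has
        exact ⟨e, _, he, hπs' s fun h => hz (h hzs)⟩
    refine ⟨rfl, K', ?_, ?_, ?_, ?_, ?_, ?_⟩
    · rintro (_ | s)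
      · have hKC : K' none ⊆ f ⁻¹' C := fun a ⟨e, y, he, hy⟩ => htoC e a y he hy
        refine ⟨hHC.subset hKC, le_trans ?_ hCk⟩
        rw [← ncard_image_of_injective _ f.injective]
        exact ncard_le_ncard (image_subset_iff.2 hKC) (toFinite _)
      · refine ⟨fun a ha b hb hab => hGH a b ((hK s.1).1 ha hb fun h => hab (f.injective h)),
          le_trans ?_ (hK s.1).2⟩
        rw [← ncard_image_of_injective _ f.injective]
        exact ncard_le_ncard (image_preimage_subset _ _) (toFinite _)
    · rintro e (_ | s) (_ | t) ⟨x, y, h, hx, hy, hn⟩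
      · exact hn ⟨rfl, rfl⟩
      · obtain rfl := (hπsome _ _).1 hy
        obtain ⟨b | s, rfl⟩ := (hπσ x).1 hx
        · obtain ⟨a, ha⟩ := t.2 ((hadj t.1 (g b.1)).1 ⟨e, h⟩)
          exact b.2 ⟨a, ha⟩
        · exact hind _ _ _ h
      · obtain rfl := (hπsome _ _).1 hx
        obtain ⟨b | t, rfl⟩ := (hπσ y).1 hy
        · obtain ⟨a, ha⟩ := s.2 ((hadj s.1 (g b.1)).1 ⟨e, h.symm⟩)
          exact b.2 ⟨a, ha⟩
        · exact hind _ _ _ h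
      · obtain rfl := (hπsome _ _).1 hx
        obtain rfl := (hπsome _ _).1 hy
        exact hind _ _ _ h
    · rintro (_ | s) a
      · constructor
        · rintro ⟨e, x, y, h, hx, hy, -⟩
          obtain rfl := (hπinl _ _).1 hx
          exact ⟨e, y, h, hy⟩
        · rintro ⟨e, y, h, hy⟩
          exact ⟨e, _, y, h, hπf a, hy, by simp⟩
      · refine Iff.trans ⟨?_, ?_⟩ (hadj s.1 (f a))
        · rintro ⟨e, x, y, h, hx, hy, -⟩
          obtain rfl := (hπinl _ _).1 hx
          obtain rfl := (hπsome _ _).1 hy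
          exact ⟨e, h⟩
        · rintro ⟨e, h⟩
          exact ⟨e, _, _, h, hπf a, hπs s.1 s.2, by simp⟩
    · intro e a b h
      exact hGH a b (hlink e _ _ ((hll e a b).1 h))
    · intro e e' a b h h'
      exact hsimp e e' _ _ ((hll e a b).1 h) ((hll e' a b).1 h')
    · intro a b hab hno
      simp only [hll] at hno
      by_cases hGab : G.Adj (f a) (f b)
      · obtain ⟨s, has, hbs⟩ := hmiss _ _ hGab hno
        by_cases hs : K s ⊆ range f
        · exact ⟨some ⟨s, hs⟩, has, hbs⟩
        · obtain ⟨e, he⟩ := (hadj s _).2 has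
          obtain ⟨e', he'⟩ := (hadj s _).2 hbs
          exact ⟨none, ⟨e, _, he, hπs' s hs⟩, ⟨e', _, he', hπs' s hs⟩⟩
      -- An edge deleted by the clique-sum has, by the deletion rule, both ends adjacent to the
      -- contracted part, so the blowup `M'` may lack it.
      · obtain ⟨-, -, ⟨z, hz, haz⟩, ⟨z', hz', hbz⟩⟩ :=
          hdel (f a) (f b) (Or.inl ((map_adj _ _ _ _).2 ⟨a, b, hab, rfl, rfl⟩)) hGab
        exact ⟨none, hdirect a z hz haz, hdirect b z' hz' hbz⟩
  have hQ : IsSimplicialBlowup k (P.induce U) (M.pullback σ hσ) := by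
    refine ⟨rfl, fun s => (fun b : U => g b.1) ⁻¹' K s.1, fun s => ⟨?_, ?_⟩,
      fun e u v => hind e u.1 v.1, fun s b => hadj s.1 (g b.1), fun e a b h => ?_,
      fun e e' a b => hsimp e e' _ _, fun a b hab hno => ?_⟩
    · intro a ha b hb hab
      exact hGP _ _ ((hK s.1).1 ha hb fun h => hab (Subtype.ext (g.injective h)))
    · refine le_trans ?_ (hK s.1).2
      rw [← ncard_image_of_injective _ (f := fun b : U => g b.1)
        (g.injective.comp Subtype.val_injective)]
      exact ncard_le_ncard (image_preimage_subset _ _) (toFinite _)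
    · exact hGP _ _ (hlink e _ _ h)
    · have hGab : G.Adj (g a.1) (g b.1) :=
        hPG _ _ (hCf _ b.2) ((map_adj _ _ _ _).2 ⟨a.1, b.1, hab, rfl, rfl⟩)
      obtain ⟨s, has, hbs⟩ := hmiss _ _ hGab hno
      exact ⟨⟨s, fun h => a.2 (h has)⟩, has, hbs⟩
  have hΔ' : ∀ a, (M.contract π (Sum.inr none)).degree (Sum.inl a) ≤ Δ := by
    intro a
    have h := M.degree_contract_le hπ (Sum.inl (f a)) (by simp [hπf])
    rw [hπf] at h
    exact h.trans (hΔ _)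
  obtain ⟨p, hp, hpgp, hpcr⟩ := hH _ E _ hM' Δ hΔ'
  obtain ⟨q, hq, hqgp, hqcr⟩ := hP.exists_drawing hc U _ E _ hQ (Δ := Δ)
    fun v => Graph.degree_pullback_le v |>.trans (hM₀.degree_le hk hΔ _)
  obtain ⟨r, hr, hrgp, h₁, h₂⟩ := exists_blowup_configuration π (Sum.inr none) σ hσ hπσ p q
  refine ⟨r, hr, hrgp, ?_⟩
  have hcross := Graph.crossingPairs_subset (hσ := hσ) hπσ hπ hM₀.not_isLink_self hp hpgp.1 h₁ h₂
  have hpairs := Graph.pairsAt_subset (M := M) (hσ := hσ) hπσ (T := range Sum.inr)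
    (T' := range Sum.inr) (by
      rintro _ ⟨s, rfl⟩
      by_cases hs : K s ⊆ range f
      · exact ⟨_, (hπs s hs).symm⟩
      · exact ⟨_, (hπs' s hs).symm⟩)
  -- Pairs meeting at the contracted vertex are already paid for by the induction hypothesis.
  have hnone : (M.contract π (Sum.inr none)).pairsAt {Sum.inr none} ⊆
      (M.contract π (Sum.inr none)).pairsAt (range Sum.inr) := by
    rintro z ⟨e, e', hne, rfl, v, hv, h⟩
    exact ⟨e, e', hne, rfl, v, ⟨none, hv.symm⟩, h⟩
  have hX₁ : {z | ∃ e ∈ (M.pullback σ hσ).edgeSet, ∃ f,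
      (M.contract π (Sum.inr none)).Inc f (Sum.inr none) ∧ z = s(e, f)}.ncard ≤
      (M.pullback σ hσ).numEdges * (k * Δ) :=
    Sym2.ncard_le_mul (F := fun _ => {f | (M.contract π (Sum.inr none)).Inc f (Sum.inr none)})
      (fun _ _ => hM'.degree_inr_le hΔ' none) fun z hz => hz
  have hX₂ : {z | ∃ e ∈ (M.pullback σ hσ).edgeSet, ∃ f,
      (∃ v ∈ range Sum.inr, M.Inc e v ∧ M.Inc f v) ∧ z = s(e, f)}.ncard ≤
      (M.pullback σ hσ).numEdges * (k * Δ) :=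
    Sym2.ncard_le_mul (fun e _ => hM₀.ncard_edges_sharing_inr_le hΔ e) fun z hz => hz
  set M' := M.contract π (Sum.inr none)
  set Q := M.pullback σ hσ
  set X₁ := {z | ∃ e ∈ Q.edgeSet, ∃ f, M'.Inc f (Sum.inr none) ∧ z = s(e, f)}
  set X₂ := {z | ∃ e ∈ Q.edgeSet, ∃ f,
      (∃ v ∈ range Sum.inr, M.Inc e v ∧ M.Inc f v) ∧ z = s(e, f)}
  have hall : M.crossingPairs r ∪ M.pairsAt (range Sum.inr) ⊆
      ((M'.crossingPairs p ∪ M'.pairsAt (range Sum.inr)) ∪ Q.crossingPairs q) ∪ (X₁ ∪ X₂) := by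
    rintro z (hz | hz)
    · rcases hcross hz with ((hz | hz) | hz) | hz
      · exact .inl (.inl (.inl hz))
      · exact .inl (.inl (.inr (hnone hz)))
      · exact .inl (.inr hz)
      · exact .inr (.inl hz)
    · rcases hpairs hz with hz | hz
      · exact .inl (.inl (.inr hz))
      · exact .inr (.inr hz)
  have hcard := (ncard_le_ncard hall (toFinite _)).trans ((ncard_union_le _ _).trans
    (add_le_add (ncard_union_le _ _) ((ncard_union_le _ _).trans (add_le_add hX₁ hX₂))))
  have hcard' : ((M.crossingPairs r ∪ M.pairsAt (range Sum.inr)).ncard : ℝ) ≤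
      (M'.crossingPairs p ∪ M'.pairsAt (range Sum.inr)).ncard + (Q.crossingPairs q).ncard +
        (Q.numEdges * (k * Δ) + Q.numEdges * (k * Δ)) := by
    exact_mod_cast hcard
  have hedges : (M'.numEdges : ℝ) + Q.numEdges ≤ M.numEdges := by
    exact_mod_cast Graph.numEdges_contract_add_pullback_le (M := M) (hσ := hσ) hπσ
  -- The share `k * (c + 2) * Δ` of each edge of `Q` covers the crossings in `Q` together with `X₁`
  -- and `X₂`.
  have hfin : (k : ℝ) * (c + 2) * Δ * (M'.numEdges + Q.numEdges) ≤
      k * (c + 2) * Δ * M.numEdges := by gcongr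
  push_cast at hqcr
  linarith

theorem ObtainedByCliqueSums.hasBlowupDrawings {ι : Type} {W : ι → Type u} [∀ i, Finite (W i)]
    {k : ℕ} (hk : 1 ≤ k) {c : ℝ} (hc : 0 < c) {P : (i : ι) → SimpleGraph (W i)}
    (hP : ∀ i, (P i).Agreeable k c) {I : Set ι} {V : Type u} {G : SimpleGraph V}
    (hG : ObtainedByCliqueSums k P I G) (hV : Finite V) :
    G.HasBlowupDrawings k c := by
  induction hG with
  | piece i G e => exact (hP i).hasBlowupDrawings hk hc e.some
  | sum I i hi H G hH hG ih =>
    have ⟨f, _⟩ := hG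
    have := Finite.of_injective f f.injective
    exact (ih this).cliqueSum hk hc (hP i) hG

/-- A simple graph as a simplicial blowup of itself, without new vertices. -/
def trivialBlowup {V : Type u} (G : SimpleGraph V) : Graph (V ⊕ PEmpty.{u + 1}) (Sym2 V) :=
  G.toMultigraph.pullback (Sum.elim id PEmpty.elim)
    (Function.Injective.sumElim Function.injective_id (fun x => x.elim) fun _ x => x.elim)

theorem isSimplicialBlowup_trivialBlowup {V : Type u} (k : ℕ) (G : SimpleGraph V) :
    IsSimplicialBlowup k G G.trivialBlowup :=
  ⟨rfl, fun u => u.elim, fun u => u.elim, fun _ u => u.elim, fun u => u.elim,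
    fun _ _ _ h => h.1, fun _ _ _ _ h h' => h.2.trans h'.2.symm,
    fun _ _ h hno => (hno _ ⟨h, rfl⟩).elim⟩

theorem degree_toMultigraph {V : Type*} [Fintype V] [DecidableEq V] (G : SimpleGraph V)
    [DecidableRel G.Adj] (v : V) : G.toMultigraph.degree v = G.degree v := by
  rw [← card_incidenceSet_eq_degree, Graph.degree, ← Nat.card_coe_set_eq,
    ← Nat.card_eq_fintype_card]
  congr! 2
  ext e
  constructor
  · rintro ⟨w, h, rfl⟩
    exact ⟨h, Sym2.mem_mk_left _ _⟩
  · rintro ⟨h, hv⟩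
    obtain ⟨w, rfl⟩ := Sym2.mem_iff_exists.1 hv
    exact ⟨w, h, rfl⟩

theorem edgeSet_toMultigraph {V : Type*} (G : SimpleGraph V) :
    G.toMultigraph.edgeSet = G.edgeSet := by
  ext e
  constructor
  · rintro ⟨v, w, h, rfl⟩
    exact h
  · induction e with | _ v w => exact fun h => ⟨v, w, h, rfl⟩

end SimpleGraph

end

/-- The strengthened statement is applied to `G` as a blowup of itself without new vertices, with
`Δ` its maximum degree. -/
theorem mainTheorem2 (k : ℕ) (hk : 1 ≤ k) (c : ℝ) (hc : 0 < c)
    (h : ℕ) (W : Fin h → Type u) [∀ i, Finite (W i)] (P : (i : Fin h) → SimpleGraph (W i))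
    (hP : ∀ i, (P i).Agreeable k c)
    {V : Type u} [Fintype V] [DecidableEq V] (G : SimpleGraph V) [DecidableRel G.Adj]
    (hG : SimpleGraph.ObtainedByCliqueSums k P Set.univ G) :
    (G.rcr : ℝ) ≤ (k : ℝ) * (c + 2) * (G.maxDegree : ℝ) * (G.edgeFinset.card : ℝ) := by
  have hB := hG.hasBlowupDrawings hk hc hP inferInstance
  have hdeg : ∀ v, G.trivialBlowup.degree (Sum.inl v) ≤ G.maxDegree := fun v =>
    Graph.degree_pullback_le (M := G.toMultigraph) _ |>.trans
      ((G.degree_toMultigraph v).trans_le (G.degree_le_maxDegree v))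
  obtain ⟨p, hp, hgp, hcr⟩ := hB PEmpty (Sym2 V) G.trivialBlowup
    (G.isSimplicialBlowup_trivialBlowup k) G.maxDegree hdeg
  have hrange : Set.range p = (p ∘ Sum.inl) '' Set.univ := by
    rw [Set.image_univ]
    ext x
    simp
  have hrcr : G.rcr ≤ (G.toMultigraph.crossingPairs (p ∘ Sum.inl)).ncard :=
    Nat.sInf_le ⟨_, ⟨(hp.comp Sum.inl_injective).injOn, hrange ▸ hgp⟩, rfl⟩
  have hsub : G.toMultigraph.crossingPairs (p ∘ Sum.inl) ⊆ G.trivialBlowup.crossingPairs p ∪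
      G.trivialBlowup.pairsAt (Set.range Sum.inr) := by
    rintro z ⟨e, f, rfl, a, b, c, d, he, hf, hac, had, hbc, hbd, hx⟩
    exact .inl ⟨e, f, rfl, Sum.inl a, Sum.inl b, Sum.inl c, Sum.inl d, he, hf, by simpa, by simpa,
      by simpa, by simpa, hx⟩
  have hedges : G.trivialBlowup.numEdges ≤ G.edgeFinset.card := by
    rw [← Set.ncard_coe_finset, SimpleGraph.coe_edgeFinset, ← SimpleGraph.edgeSet_toMultigraph]
    refine Set.ncard_le_ncard ?_ (Set.toFinite _)
    rintro e ⟨x, y, h⟩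
    exact Graph.IsLink.edge_mem h
  have h₁ : (G.rcr : ℝ) ≤ (G.trivialBlowup.crossingPairs p ∪
      G.trivialBlowup.pairsAt (Set.range Sum.inr)).ncard := by
    exact_mod_cast hrcr.trans (Set.ncard_le_ncard hsub (Set.toFinite _))
  have h₂ : (G.trivialBlowup.numEdges : ℝ) ≤ G.edgeFinset.card := by exact_mod_cast hedges
  refine h₁.trans (hcr.trans ?_)
  gcongr
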